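/- Let $V$ be a finite-dimensional Euclidean space and let $W$ be a finite reflection group on $V$, i.e. a finite group of linear isometries of $V$ generated by orthogonal reflections in hyperplanes. Let $V^W$ be the subspace of vectors fixed by $W$, and let $n=\dim V-\dim V^W$ (so $n=\dim V$ if $W$ is essential). Let $C$ be a closed fundamental chamber of $W$, i.e. the closure of a connected component of the complement in $V$ of the union of the reflection hyperplanes of $W$. For $w\in W$ put $C_w=(1-w)C$, and call $w\in W$ regular if its set of fixed vectors is exactly $V^W$. The dimension of a convex cone with apex $0$ is the dimension of its linear span. For $w,w'\in W$ with $\dim C_{w'}<\dim C_w$, the cone $C_{w'}$ is called adjacent to $C_w$ if $\dim C_{w'}=\dim(C_{w'}\cap C_w)$. Let $w',\tilde w\in W$ be such that $w=w'\tilde w$ is regular, and suppose that $\dim C_{w'}<\dim C_w$ and that $C_{w'}$ is adjacent to $C_w$. Then $$\operatorname{rk}(1-w')+\operatorname{rk}(1-\tilde w)=n.$$ -/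

import Mathlib

open Module

noncomputable section

namespace ReflectionTiling

variable {V : Type*} [NormedAddCommGroup V] [InnerProductSpace ℝ V] [FiniteDimensional ℝ V]

/-- The orthogonal reflection `s_u` in the hyperplane orthogonal to `u` (used for `u ≠ 0`). -/
def hyperplaneRefl (u : V) : V ≃ₗᵢ[ℝ] V := (ℝ ∙ u)ᗮ.reflection

/-- `u` is a root vector of `W`: a nonzero normal vector of a reflection hyperplane of `W`. -/
def IsRootVector (W : Subgroup (V ≃ₗᵢ[ℝ] V)) (u : V) : Prop :=
  u ≠ 0 ∧ hyperplaneRefl u ∈ W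

/-- A finite reflection group acting on the Euclidean space `V`: a finite group of linear
isometries of `V` generated by the orthogonal reflections it contains.
It is allowed to have nonzero fixed vectors. -/
def IsFiniteReflectionGroup (W : Subgroup (V ≃ₗᵢ[ℝ] V)) : Prop :=
  Finite W ∧ Subgroup.closure {s | ∃ u : V, IsRootVector W u ∧ s = hyperplaneRefl u} = W

/-- The open chamber of `W` through `x`: the points that lie strictly on the same side as `x` of
every reflection hyperplane of `W` (used for `x` on no reflection hyperplane). -/
def openChamber (W : Subgroup (V ≃ₗᵢ[ℝ] V)) (x : V) : Set V :=
  {y | ∀ u : V, IsRootVector W u → 0 < inner ℝ u x * inner ℝ u y}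

/-- `C` is a (closed) fundamental chamber of `W`: the closure of an open chamber. -/
def IsFundamentalChamber (W : Subgroup (V ≃ₗᵢ[ℝ] V)) (C : Set V) : Prop :=
  ∃ x : V, (∀ u : V, IsRootVector W u → inner ℝ u x ≠ 0) ∧ C = closure (openChamber W x)

/-- The subspace `V^W` of vectors fixed by `W`. -/
def fixedSubspace (W : Subgroup (V ≃ₗᵢ[ℝ] V)) : Submodule ℝ V where
  carrier := {v | ∀ g ∈ W, g v = v}
  zero_mem' := fun g _ => map_zero g
  add_mem' := fun {a b} ha hb g hg => by rw [map_add, ha g hg, hb g hg]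
  smul_mem' := fun c a ha g hg => by rw [map_smul, ha g hg]

/-- `w ∈ W_reg`: `w` is an element of `W` whose fixed vectors are exactly those of `W`. -/
def IsRegular (W : Subgroup (V ≃ₗᵢ[ℝ] V)) (w : V ≃ₗᵢ[ℝ] V) : Prop :=
  w ∈ W ∧ {v : V | w v = v} = (fixedSubspace W : Set V)

/-- The linear operator `1 - w`. -/
def oneSub (w : V ≃ₗᵢ[ℝ] V) : V →ₗ[ℝ] V :=
  LinearMap.id - w.toLinearEquiv.toLinearMap

/-- The rank `rk (1 - w)`. -/
def rk (w : V ≃ₗᵢ[ℝ] V) : ℕ := finrank ℝ (LinearMap.range (oneSub w))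

/-- The cone `C_w = (1 - w) C`. -/
def cone (C : Set V) (w : V ≃ₗᵢ[ℝ] V) : Set V := oneSub w '' C

/-- The dimension of a convex cone with apex `0`: the dimension of its linear span. -/
def coneDim (K : Set V) : ℕ := finrank ℝ (Submodule.span ℝ K)

/-- The cone `K'` is of strictly smaller dimension than the cone `K` and is adjacent to `K`:
`dim K' < dim K` and `dim K' = dim (K' ∩ K)`. -/
def IsAdjacentTo (K' K : Set V) : Prop :=
  coneDim K' < coneDim K ∧ coneDim K' = coneDim (K' ∩ K)

end ReflectionTiling

end

/-! Write `w = w' w̃`. Subadditivity of `rk` gives `n = rk (1 - w) ≤ rk (1 - w') + rk (1 - w̃)`. The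
reverse bound follows from `range (1 - w') ⊆ (1 - w) ker (1 - w̃)`: since `ker (1 - w) = V^W` lies
in `ker (1 - w̃)`, the right side has dimension `dim ker (1 - w̃) - dim V^W = n - rk (1 - w̃)`. For
the inclusion, let `(1 - w') p = (1 - w) y` with `p` in the open chamber and `y` in the closed one.
Then `p - y = w' (p - w̃ y)`, so `⟨p, y⟩ = ⟨p, w̃ y⟩`. As `y` is the only maximum of `⟨p, ·⟩` on its
orbit (`SameSide.eq_of_inner_le`), `w̃ y = y`. Adjacency makes such points span `range (1 - w')`.
Uniqueness of the maximum is a confluence argument: reflections raising `⟨x, ·⟩` form a terminating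
rewriting system on an orbit, and local confluence reduces to dihedral groups. -/

namespace ReflectionTiling

/-! ### Identities for reflections and root vectors. -/

section Reflections

variable {V : Type*} [NormedAddCommGroup V] [InnerProductSpace ℝ V]

theorem hyperplaneRefl_apply (u v : V) :
    hyperplaneRefl u v = v - (2 * inner ℝ u v / ‖u‖ ^ 2) • u := by
  rw [hyperplaneRefl, Submodule.reflection_orthogonal_apply, Submodule.reflection_singleton_apply,
    neg_sub, two_smul, ← add_smul]
  congr 2
  simp only [RCLike.ofReal_real_eq_id, id_eq]
  ring

theorem hyperplaneRefl_mul_self (u : V) : hyperplaneRefl u * hyperplaneRefl u = 1 :=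
  Submodule.reflection_mul_reflection _

theorem hyperplaneRefl_inv (u : V) : (hyperplaneRefl u)⁻¹ = hyperplaneRefl u :=
  inv_eq_of_mul_eq_one_left (hyperplaneRefl_mul_self u)

theorem hyperplaneRefl_map (g : V ≃ₗᵢ[ℝ] V) (u : V) :
    hyperplaneRefl (g u) = g * hyperplaneRefl u * g⁻¹ := by
  ext v
  have h : inner ℝ u (g⁻¹ v) = inner ℝ (g u) v := by
    rw [← g.inner_map_map u, ← Function.comp_apply (f := g), ← LinearIsometryEquiv.coe_mul,
      mul_inv_cancel, LinearIsometryEquiv.coe_one, id]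
  have h' : g (g⁻¹ v) = v := by
    rw [← Function.comp_apply (f := g), ← LinearIsometryEquiv.coe_mul,
      mul_inv_cancel, LinearIsometryEquiv.coe_one, id]
  simp only [LinearIsometryEquiv.coe_mul, Function.comp_apply, hyperplaneRefl_apply, map_sub,
    map_smul, h, h', LinearIsometryEquiv.norm_map]

theorem hyperplaneRefl_apply_of_inner_eq_zero {u v : V} (h : inner ℝ u v = 0) :
    hyperplaneRefl u v = v := by
  simp [hyperplaneRefl_apply, h]

theorem inner_hyperplaneRefl_self {u : V} (hu : u ≠ 0) (v : V) :
    inner ℝ u (hyperplaneRefl u v) = - inner ℝ u v := by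
  have : ‖u‖ ≠ 0 := norm_ne_zero_iff.mpr hu
  rw [hyperplaneRefl_apply, inner_sub_right, inner_smul_right, real_inner_self_eq_norm_sq]
  field_simp
  ring

theorem inner_hyperplaneRefl (u x v : V) :
    inner ℝ x (hyperplaneRefl u v) =
      inner ℝ x v - 2 / ‖u‖ ^ 2 * (inner ℝ u x * inner ℝ u v) := by
  rw [hyperplaneRefl_apply, inner_sub_right, inner_smul_right, real_inner_comm x u]
  ring

theorem inner_lt_inner_hyperplaneRefl_iff {u : V} (hu : u ≠ 0) (x v : V) :
    inner ℝ x v < inner ℝ x (hyperplaneRefl u v) ↔ inner ℝ u x * inner ℝ u v < 0 := by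
  have h : 0 < 2 / ‖u‖ ^ 2 := by have := norm_pos_iff.mpr hu; positivity
  rw [inner_hyperplaneRefl]
  constructor
  · intro h1
    by_contra! h2
    nlinarith [mul_nonneg h.le h2]
  · intro h1
    nlinarith [mul_neg_of_pos_of_neg h h1]

theorem IsRootVector.map {W : Subgroup (V ≃ₗᵢ[ℝ] V)} {u : V} (hu : IsRootVector W u)
    {g : V ≃ₗᵢ[ℝ] V} (hg : g ∈ W) : IsRootVector W (g u) := by
  refine ⟨by simpa using hu.1, ?_⟩
  rw [hyperplaneRefl_map]
  exact W.mul_mem (W.mul_mem hg hu.2) (W.inv_mem hg)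

theorem IsRootVector.mono {W W' : Subgroup (V ≃ₗᵢ[ℝ] V)} (h : W ≤ W') {u : V}
    (hu : IsRootVector W u) : IsRootVector W' u :=
  ⟨hu.1, h hu.2⟩

/-! ### Ascending reflections and their confluence. -/

/-- `y` lies weakly on the same side as `x` of every reflection hyperplane of `W`. -/
def SameSide (W : Subgroup (V ≃ₗᵢ[ℝ] V)) (x y : V) : Prop :=
  ∀ u : V, IsRootVector W u → 0 ≤ inner ℝ u x * inner ℝ u y

/-- `z'` is a reflection of `z` that is strictly higher than `z` with respect to `x`. -/
def Ascends (W : Subgroup (V ≃ₗᵢ[ℝ] V)) (x z z' : V) : Prop :=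
  ∃ u : V, IsRootVector W u ∧ z' = hyperplaneRefl u z ∧ inner ℝ x z < inner ℝ x z'

theorem Ascends.mono {W W' : Subgroup (V ≃ₗᵢ[ℝ] V)} (h : W ≤ W') {x z z' : V}
    (hz : Ascends W x z z') : Ascends W' x z z' := by
  obtain ⟨u, hu, h1, h2⟩ := hz
  exact ⟨u, hu.mono h, h1, h2⟩

theorem reflTransGen_ascends_le {W : Subgroup (V ≃ₗᵢ[ℝ] V)} {x z z' : V}
    (h : Relation.ReflTransGen (Ascends W x) z z') : inner ℝ x z ≤ inner ℝ x z' := by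
  induction h with
  | refl => exact le_rfl
  | tail _ h ih => obtain ⟨u, -, -, h⟩ := h; exact ih.trans h.le

theorem eq_or_inner_lt_of_reflTransGen_ascends {W : Subgroup (V ≃ₗᵢ[ℝ] V)} {x z z' : V}
    (h : Relation.ReflTransGen (Ascends W x) z z') : z = z' ∨ inner ℝ x z < inner ℝ x z' := by
  rcases h.cases_head with h | ⟨y, ⟨u, -, -, h1⟩, h2⟩
  · exact Or.inl h
  · exact Or.inr (h1.trans_le (reflTransGen_ascends_le h2))

theorem SameSide.not_ascends {W : Subgroup (V ≃ₗᵢ[ℝ] V)} {x z z' : V} (hz : SameSide W x z) :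
    ¬ Ascends W x z z' := by
  rintro ⟨u, hu, rfl, h⟩
  exact absurd ((inner_lt_inner_hyperplaneRefl_iff hu.1 x z).1 h) (not_lt.2 (hz u hu))

/-- Every point can be moved by ascending reflections into the closed chamber of `x`. -/
theorem exists_reflTransGen_ascends_sameSide {W : Subgroup (V ≃ₗᵢ[ℝ] V)} [Finite W] (x z : V) :
    ∃ g ∈ W, Relation.ReflTransGen (Ascends W x) z (g z) ∧ SameSide W x (g z) := by
  have hfin : {g : V ≃ₗᵢ[ℝ] V | g ∈ W ∧ Relation.ReflTransGen (Ascends W x) z (g z)}.Finite :=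
    (Set.toFinite (W : Set (V ≃ₗᵢ[ℝ] V))).subset fun g hg => hg.1
  obtain ⟨g, ⟨hg, hzg⟩, hmax⟩ := Set.exists_max_image _ (fun g => inner ℝ x (g z)) hfin
    ⟨1, W.one_mem, Relation.ReflTransGen.refl⟩
  refine ⟨g, hg, hzg, fun u hu => ?_⟩
  by_contra! hlt
  have hup := (inner_lt_inner_hyperplaneRefl_iff hu.1 x (g z)).2 hlt
  exact absurd hup (not_lt.2 (hmax (hyperplaneRefl u * g)
    ⟨W.mul_mem hu.2 hg, hzg.tail ⟨u, hu, rfl, hup⟩⟩))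

/-- The reflection negates `⟨u, p⟩`, yet both values must weakly share the sign of `⟨u, x⟩ ≠ 0`;
hence `⟨u, p⟩ = 0`. -/
theorem SameSide.eq_of_hyperplaneRefl {W : Subgroup (V ≃ₗᵢ[ℝ] V)} {x p u : V}
    (hx : ∀ u : V, IsRootVector W u → inner ℝ u x ≠ 0) (hu : IsRootVector W u)
    (hp : SameSide W x p) (hq : SameSide W x (hyperplaneRefl u p)) :
    hyperplaneRefl u p = p := by
  apply hyperplaneRefl_apply_of_inner_eq_zero
  have h1 := hp u hu
  have h2 := hq u hu
  rw [inner_hyperplaneRefl_self hu.1] at h2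
  exact (mul_eq_zero.1 (le_antisymm (by linarith) h1)).resolve_left (hx u hu)

/-- From `s_a σ = s_b σ` one gets a linear relation between `a` and `b`; if `⟨a, σ⟩ ≠ 0` it makes
them parallel, so `s_a = s_b`. -/
theorem inner_eq_zero_or_eq_one_of_fixed {a b σ : V} (ha : a ≠ 0)
    (hσ : (hyperplaneRefl a * hyperplaneRefl b) σ = σ) :
    inner ℝ a σ = 0 ∨ hyperplaneRefl a * hyperplaneRefl b = 1 := by
  by_cases h0 : inner ℝ a σ = 0
  · exact Or.inl h0
  right
  have h1 : hyperplaneRefl b σ = hyperplaneRefl a σ := by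
    have := congrArg (hyperplaneRefl a) hσ
    rwa [← Function.comp_apply (f := hyperplaneRefl a), ← LinearIsometryEquiv.coe_mul,
      ← mul_assoc, hyperplaneRefl_mul_self, one_mul] at this
  rw [hyperplaneRefl_apply, hyperplaneRefl_apply, sub_right_inj] at h1
  have hc : 2 * inner ℝ a σ / ‖a‖ ^ 2 ≠ 0 := by
    have := norm_ne_zero_iff.mpr ha
    positivity
  set c := 2 * inner ℝ a σ / ‖a‖ ^ 2
  set d := 2 * inner ℝ b σ / ‖b‖ ^ 2
  have hab : a = (c⁻¹ * d) • b := by rw [mul_smul, h1, inv_smul_smul₀ hc]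
  have he : c⁻¹ * d ≠ 0 := by
    intro h
    rw [h, zero_smul] at hab
    exact ha hab
  have hs : hyperplaneRefl a = hyperplaneRefl b := by
    unfold hyperplaneRefl
    congr 2
    rw [hab]
    exact Submodule.span_singleton_smul_eq (IsUnit.mk0 _ he) b
  rw [hs, hyperplaneRefl_mul_self]

/-- A rotation `s_a s_b` cannot move a point of a closed chamber to another one. -/
theorem SameSide.eq_of_mul_hyperplaneRefl {W : Subgroup (V ≃ₗᵢ[ℝ] V)} [Finite W] {x p a b : V}
    (hx : ∀ u : V, IsRootVector W u → inner ℝ u x ≠ 0)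
    (ha : IsRootVector W a) (hb : IsRootVector W b)
    (hp : SameSide W x p) (hq : SameSide W x ((hyperplaneRefl a * hyperplaneRefl b) p)) :
    (hyperplaneRefl a * hyperplaneRefl b) p = p := by
  set g := hyperplaneRefl a * hyperplaneRefl b with hg
  have hgW : g ∈ W := W.mul_mem ha.2 hb.2
  have hroot : ∀ k : ℕ, IsRootVector W ((g ^ k) a) := fun k => ha.map (W.pow_mem hgW k)
  -- If `p` lies on the mirror of some `g ^ k a`, then `g` can be replaced at `p` by a single
  -- reflection.
  by_cases hz : ∃ k : ℕ, inner ℝ ((g ^ k) a) p = 0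
  · obtain ⟨k, hk⟩ := hz
    have hfix := hyperplaneRefl_apply_of_inner_eq_zero hk
    have hc : IsRootVector W ((g ^ k * hyperplaneRefl a) b) :=
      hb.map (W.mul_mem (W.pow_mem hgW k) ha.2)
    have hgc : g * hyperplaneRefl ((g ^ k) a) = hyperplaneRefl ((g ^ k * hyperplaneRefl a) b) := by
      rw [hyperplaneRefl_map, hyperplaneRefl_map, mul_inv_rev, hyperplaneRefl_inv,
        ← mul_assoc, ← mul_assoc, ← mul_assoc, (Commute.self_pow g k).eq]
      simp only [hg, mul_assoc]
    have hgp : g p = hyperplaneRefl ((g ^ k * hyperplaneRefl a) b) p := by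
      rw [← hgc, LinearIsometryEquiv.coe_mul g, Function.comp_apply, hfix]
    rw [hgp] at hq ⊢
    exact hp.eq_of_hyperplaneRefl hx hc hq
  · push Not at hz
    -- Since `⟨g ^ (k+1) a, g p⟩ = ⟨g ^ k a, p⟩`, consecutive values both share the sign of `⟨g ^
    -- (k+1) a, x⟩`; thus all of them have one sign.
    have hstep : ∀ k : ℕ, 0 < inner ℝ ((g ^ k) a) p * inner ℝ ((g ^ (k + 1)) a) p := by
      intro k
      have h1 := hp _ (hroot (k + 1))
      have h2 := hq _ (hroot (k + 1))
      have h3 : inner ℝ ((g ^ (k + 1)) a) (g p) = inner ℝ ((g ^ k) a) p := by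
        rw [pow_succ', LinearIsometryEquiv.coe_mul, Function.comp_apply, g.inner_map_map]
      rw [h3] at h2
      have h4 := hx _ (hroot (k + 1))
      have h5 : 0 < inner ℝ ((g ^ (k + 1)) a) x * inner ℝ ((g ^ (k + 1)) a) p :=
        h1.lt_of_ne' (mul_ne_zero h4 (hz _))
      have h6 : 0 < inner ℝ ((g ^ (k + 1)) a) x * inner ℝ ((g ^ k) a) p :=
        h2.lt_of_ne' (mul_ne_zero h4 (hz _))
      have h7 := mul_pos h5 h6
      by_contra! h8
      nlinarith [mul_nonpos_of_nonneg_of_nonpos (sq_nonneg (inner ℝ ((g ^ (k + 1)) a) x)) h8]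
    have hsign : ∀ k : ℕ, 0 < inner ℝ ((g ^ 0) a) p * inner ℝ ((g ^ k) a) p := by
      intro k
      induction k with
      | zero => exact mul_self_pos.2 (hz 0)
      | succ k ih =>
        have h7 := mul_pos ih (hstep k)
        by_contra! h8
        nlinarith [mul_nonpos_of_nonneg_of_nonpos (sq_nonneg (inner ℝ ((g ^ k) a) p)) h8]
    have hord : IsOfFinOrder g := by
      have := isOfFinOrder_of_finite (⟨g, hgW⟩ : W)
      simpa using (Subgroup.subtype W).isOfFinOrder this
    have hN := hord.orderOf_pos
    -- The sum over the period of `g` is `g`-fixed, and `⟨σ, p⟩ ≠ 0` by the constant sign. If `a ⟂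
    -- σ`, then every `g ^ k a ⟂ σ`, forcing `σ = 0`; so `g = 1`.
    set σ : V := ∑ k ∈ Finset.range (orderOf g), (g ^ k) a with hσ
    have hgσ : g σ = σ := by
      have h1 : g σ = ∑ k ∈ Finset.range (orderOf g), (g ^ (k + 1)) a := by
        rw [hσ, map_sum]
        refine Finset.sum_congr rfl fun k _ => ?_
        rw [pow_succ', LinearIsometryEquiv.coe_mul g, Function.comp_apply]
      have h2 := Finset.sum_range_succ' (fun k => (g ^ k) a) (orderOf g)
      rw [Finset.sum_range_succ, pow_orderOf_eq_one, pow_zero] at h2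
      rw [h1, hσ]
      exact (add_right_cancel h2).symm
    rcases inner_eq_zero_or_eq_one_of_fixed ha.1 hgσ with h | h
    · exfalso
      have hpow : ∀ k : ℕ, (g ^ k) σ = σ := by
        intro k
        induction k with
        | zero => simp
        | succ k ih => rw [pow_succ, LinearIsometryEquiv.coe_mul, Function.comp_apply, hgσ, ih]
      have hσ0 : σ = 0 := by
        rw [← inner_self_eq_zero (𝕜 := ℝ)]
        nth_rewrite 1 [hσ]
        rw [sum_inner]
        refine Finset.sum_eq_zero fun k _ => ?_
        rw [← hpow k, LinearIsometryEquiv.inner_map_map, h]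
      have hpos : 0 < inner ℝ ((g ^ 0) a) p * inner ℝ σ p := by
        rw [hσ, sum_inner, Finset.mul_sum]
        exact Finset.sum_pos (fun k _ => hsign k) ⟨0, Finset.mem_range.2 hN⟩
      rw [hσ0, inner_zero_left, mul_zero] at hpos
      exact lt_irrefl _ hpos
    · rw [hg, h, LinearIsometryEquiv.coe_one, id]

/-- An element of the dihedral group generated by `s_u` and `s_v` is a reflection or the product
of two reflections. -/
theorem mem_closure_pair_hyperplaneRefl {u v : V} (hu : u ≠ 0) (hv : v ≠ 0) {d : V ≃ₗᵢ[ℝ] V}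
    (hd : d ∈ Subgroup.closure {hyperplaneRefl u, hyperplaneRefl v}) :
    ∃ a b : V, IsRootVector (Subgroup.closure {hyperplaneRefl u, hyperplaneRefl v}) a ∧
      IsRootVector (Subgroup.closure {hyperplaneRefl u, hyperplaneRefl v}) b ∧
      (d = hyperplaneRefl a ∨ d = hyperplaneRefl a * hyperplaneRefl b) := by
  set D := Subgroup.closure {hyperplaneRefl u, hyperplaneRefl v} with hD
  have hu' : IsRootVector D u := ⟨hu, Subgroup.subset_closure (by simp)⟩
  have hv' : IsRootVector D v := ⟨hv, Subgroup.subset_closure (by simp)⟩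
  set r := hyperplaneRefl u * hyperplaneRefl v with hr
  have hrD : r ∈ D := D.mul_mem hu'.2 hv'.2
  have hinv : hyperplaneRefl u * r * (hyperplaneRefl u)⁻¹ = r⁻¹ := by
    rw [hr, mul_inv_rev, hyperplaneRefl_inv, hyperplaneRefl_inv, ← mul_assoc,
      hyperplaneRefl_mul_self, one_mul]
  have hcomm : ∀ k : ℤ, hyperplaneRefl u * r ^ k = r ^ (-k) * hyperplaneRefl u := by
    intro k
    have := conj_zpow (i := k) (a := hyperplaneRefl u) (b := r)
    rw [hinv, inv_zpow'] at this
    rw [this, inv_mul_cancel_right]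
  have hv_eq : hyperplaneRefl v = hyperplaneRefl u * r := by
    rw [hr, ← mul_assoc, hyperplaneRefl_mul_self, one_mul]
  have hform : ∃ k : ℤ, d = r ^ k ∨ d = r ^ k * hyperplaneRefl u := by
    have hmulu : ∀ y : V ≃ₗᵢ[ℝ] V, (∃ k : ℤ, y = r ^ k ∨ y = r ^ k * hyperplaneRefl u) →
        ∃ k : ℤ, hyperplaneRefl u * y = r ^ k ∨ hyperplaneRefl u * y = r ^ k * hyperplaneRefl u := by
      rintro y ⟨k, rfl | rfl⟩
      · exact ⟨-k, Or.inr (hcomm k)⟩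
      · exact ⟨-k, Or.inl (by rw [← mul_assoc, hcomm, mul_assoc, hyperplaneRefl_mul_self, mul_one])⟩
    have hmulv : ∀ y : V ≃ₗᵢ[ℝ] V, (∃ k : ℤ, y = r ^ k ∨ y = r ^ k * hyperplaneRefl u) →
        ∃ k : ℤ, hyperplaneRefl v * y = r ^ k ∨ hyperplaneRefl v * y = r ^ k * hyperplaneRefl u := by
      rintro y ⟨k, hy⟩
      rw [hv_eq, mul_assoc (hyperplaneRefl u)]
      refine hmulu _ ⟨1 + k, ?_⟩
      rcases hy with rfl | rfl
      · exact Or.inl (by rw [zpow_add, zpow_one])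
      · exact Or.inr (by rw [zpow_add, zpow_one, mul_assoc r])
    induction hd using Subgroup.closure_induction_left with
    | one => exact ⟨0, Or.inl (by simp)⟩
    | mul_left s hs y _ ih =>
      rcases hs with rfl | rfl
      · exact hmulu y ih
      · exact hmulv y ih
    | inv_mul_cancel s hs y _ ih =>
      rcases hs with rfl | rfl
      · rw [hyperplaneRefl_inv]; exact hmulu y ih
      · rw [hyperplaneRefl_inv]; exact hmulv y ih
  -- `r ^ (2j) s_u` is `s_u` conjugated by `r ^ j`; `r ^ (2j+1) s_u` is `s_v` conjugated by `r ^ j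
  -- s_u`.
  have hodd : ∀ k : ℤ, ∃ a : V, IsRootVector D a ∧ r ^ k * hyperplaneRefl u = hyperplaneRefl a := by
    intro k
    rcases Int.even_or_odd' k with ⟨j, rfl | rfl⟩
    · refine ⟨(r ^ j) u, hu'.map (D.zpow_mem hrD j), ?_⟩
      rw [hyperplaneRefl_map, ← zpow_neg, mul_assoc, hcomm, neg_neg, ← mul_assoc, ← zpow_add,
        two_mul]
    · refine ⟨(r ^ j * hyperplaneRefl u) v, hv'.map (D.mul_mem (D.zpow_mem hrD j) hu'.2), ?_⟩
      have h1 : hyperplaneRefl u * hyperplaneRefl v * hyperplaneRefl u = r * hyperplaneRefl u := rfl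
      rw [hyperplaneRefl_map, mul_inv_rev, hyperplaneRefl_inv, ← zpow_neg, mul_assoc, mul_assoc,
        ← mul_assoc (hyperplaneRefl v), ← mul_assoc (hyperplaneRefl u), ← mul_assoc (hyperplaneRefl u),
        h1, mul_assoc, hcomm, neg_neg, ← mul_assoc, ← mul_assoc, mul_assoc (r ^ j), ← zpow_one_add,
        ← zpow_add]
      congr 2
      ring
  obtain ⟨k, h | h⟩ := hform
  · obtain ⟨a, ha, hak⟩ := hodd k
    refine ⟨a, u, ha, hu', Or.inr ?_⟩
    rw [h, ← hak, mul_assoc, hyperplaneRefl_mul_self, mul_one]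
  · obtain ⟨a, ha, hak⟩ := hodd k
    exact ⟨a, u, ha, hu', Or.inl (h.trans hak)⟩

/-- Two ascending reflections of the same point can be continued to a common higher point. -/
theorem Ascends.exists_join {W : Subgroup (V ≃ₗᵢ[ℝ] V)} [Finite W] {x z z₁ z₂ : V}
    (hx : ∀ u : V, IsRootVector W u → inner ℝ u x ≠ 0)
    (h₁ : Ascends W x z z₁) (h₂ : Ascends W x z z₂) :
    ∃ g ∈ W, Relation.ReflTransGen (Ascends W x) z₁ (g z₁) ∧
      Relation.ReflTransGen (Ascends W x) z₂ (g z₁) := by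
  obtain ⟨u, hu, rfl, -⟩ := h₁
  obtain ⟨v, hv, rfl, -⟩ := h₂
  set D := Subgroup.closure {hyperplaneRefl u, hyperplaneRefl v} with hD
  have hDW : D ≤ W := by
    rw [hD, Subgroup.closure_le]
    rintro s (rfl | rfl)
    exacts [hu.2, hv.2]
  have : Finite D := Set.Finite.subset (Set.toFinite (W : Set (V ≃ₗᵢ[ℝ] V))) hDW
  have huD : hyperplaneRefl u ∈ D := Subgroup.subset_closure (by simp)
  have hvD : hyperplaneRefl v ∈ D := Subgroup.subset_closure (by simp)
  have hxD : ∀ u : V, IsRootVector D u → inner ℝ u x ≠ 0 := fun u hu => hx u (hu.mono hDW)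
  obtain ⟨d₁, hd₁, hup₁, hs₁⟩ :=
    exists_reflTransGen_ascends_sameSide (W := D) x (hyperplaneRefl u z)
  obtain ⟨d₂, hd₂, hup₂, hs₂⟩ :=
    exists_reflTransGen_ascends_sameSide (W := D) x (hyperplaneRefl v z)
  -- `e` carries one top point in the closed `D`-chamber to the other, so the dihedral case
  -- identifies them.
  set e := d₂ * hyperplaneRefl v * (d₁ * hyperplaneRefl u)⁻¹ with he
  have heD : e ∈ D := D.mul_mem (D.mul_mem hd₂ hvD) (D.inv_mem (D.mul_mem hd₁ huD))
  have hez : e (d₁ (hyperplaneRefl u z)) = d₂ (hyperplaneRefl v z) := by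
    have : (e * (d₁ * hyperplaneRefl u)) z = (d₂ * hyperplaneRefl v) z := by
      rw [he, inv_mul_cancel_right]
    exact this
  have heq : d₂ (hyperplaneRefl v z) = d₁ (hyperplaneRefl u z) := by
    rw [← hez] at hs₂ ⊢
    obtain ⟨a, b, ha, hb, h | h⟩ := mem_closure_pair_hyperplaneRefl hu.1 hv.1 heD
    · rw [h] at hs₂ ⊢
      exact hs₁.eq_of_hyperplaneRefl hxD ha hs₂
    · rw [h] at hs₂ ⊢
      exact hs₁.eq_of_mul_hyperplaneRefl hxD ha hb hs₂
  refine ⟨d₁, hDW hd₁, Relation.ReflTransGen.mono (fun _ _ h => h.mono hDW) _ _ hup₁, ?_⟩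
  rw [← heq]
  exact Relation.ReflTransGen.mono (fun _ _ h => h.mono hDW) _ _ hup₂

/-- The point of the closed chamber reached from `z` by ascending reflections is unique. -/
theorem sameSide_unique_of_reflTransGen_ascends {W : Subgroup (V ≃ₗᵢ[ℝ] V)} [Finite W] {x z m m' : V}
    (hx : ∀ u : V, IsRootVector W u → inner ℝ u x ≠ 0)
    (hm : Relation.ReflTransGen (Ascends W x) z m) (hms : SameSide W x m)
    (hm' : Relation.ReflTransGen (Ascends W x) z m') (hms' : SameSide W x m') : m = m' := by
  let B : Set (V ≃ₗᵢ[ℝ] V) := {g | g ∈ W ∧ ∃ m m' : V,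
    Relation.ReflTransGen (Ascends W x) (g z) m ∧ SameSide W x m ∧
    Relation.ReflTransGen (Ascends W x) (g z) m' ∧ SameSide W x m' ∧ m ≠ m'}
  have hB : B.Finite := (Set.toFinite (W : Set (V ≃ₗᵢ[ℝ] V))).subset fun g hg => hg.1
  by_contra hne
  -- Newman's lemma by extremality: a highest bad point of the orbit has only good points above it.
  obtain ⟨g, ⟨hg, p, p', hp, hps, hp', hps', hpp⟩, hmax⟩ :=
    Set.exists_max_image B (fun g => inner ℝ x (g z)) hB
      ⟨1, W.one_mem, m, m', hm, hms, hm', hms', hne⟩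
  have hgood : ∀ y, Ascends W x (g z) y → ∀ q q', Relation.ReflTransGen (Ascends W x) y q →
      SameSide W x q → Relation.ReflTransGen (Ascends W x) y q' → SameSide W x q' → q = q' := by
    rintro y ⟨u, hu, rfl, hlt⟩ q q' hq hqs hq' hqs'
    by_contra hqq
    exact absurd hlt (not_lt.2 (hmax (hyperplaneRefl u * g)
      ⟨W.mul_mem hu.2 hg, q, q', hq, hqs, hq', hqs', hqq⟩))
  rcases hp.cases_head with h | ⟨y, hy, hyp⟩
  · rcases hp'.cases_head with h' | ⟨y', hy', -⟩
    · exact hpp (h.symm.trans h')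
    · rw [h] at hy'
      exact hps.not_ascends hy'
  · rcases hp'.cases_head with h' | ⟨y', hy', hyp'⟩
    · rw [h'] at hy
      exact hps'.not_ascends hy
    · obtain ⟨d, -, hd, hd'⟩ := hy.exists_join hx hy'
      obtain ⟨e, -, he, hes⟩ := exists_reflTransGen_ascends_sameSide (W := W) x (d y)
      exact hpp ((hgood y hy _ _ hyp hps (hd.trans he) hes).trans
        (hgood y' hy' _ _ (hd'.trans he) hes hyp' hps'))

/-- A point of the closed chamber of `x` is reached from every point of its orbit by ascending
reflections. -/
theorem SameSide.reflTransGen_ascends {W : Subgroup (V ≃ₗᵢ[ℝ] V)} (hW : IsFiniteReflectionGroup W)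
    {x y : V} (hx : ∀ u : V, IsRootVector W u → inner ℝ u x ≠ 0) (hy : SameSide W x y)
    {g : V ≃ₗᵢ[ℝ] V} (hg : g ∈ W) : Relation.ReflTransGen (Ascends W x) (g y) y := by
  have := hW.1
  -- Ascending to `y` survives any reflection, up or down; as reflections generate `W`, this covers
  -- the orbit.
  have hstep : ∀ (u z : V), IsRootVector W u → Relation.ReflTransGen (Ascends W x) z y →
      Relation.ReflTransGen (Ascends W x) (hyperplaneRefl u z) y := by
    intro u z hu hz
    have hback : hyperplaneRefl u (hyperplaneRefl u z) = z := by
      rw [← Function.comp_apply (f := hyperplaneRefl u), ← LinearIsometryEquiv.coe_mul,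
        hyperplaneRefl_mul_self, LinearIsometryEquiv.coe_one, id]
    rcases lt_trichotomy (inner ℝ x z) (inner ℝ x (hyperplaneRefl u z)) with h | h | h
    · obtain ⟨d, -, hd, hds⟩ := exists_reflTransGen_ascends_sameSide (W := W) x (hyperplaneRefl u z)
      have := sameSide_unique_of_reflTransGen_ascends hx (hd.head ⟨u, hu, rfl, h⟩) hds hz hy
      rwa [this] at hd
    · have h0 : inner ℝ u z = 0 := by
        rw [inner_hyperplaneRefl] at h
        have hn : 2 / ‖u‖ ^ 2 ≠ 0 := by
          have := norm_ne_zero_iff.mpr hu.1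
          positivity
        have h1 : 2 / ‖u‖ ^ 2 * (inner ℝ u x * inner ℝ u z) = 0 := by linarith
        exact ((mul_eq_zero.1 h1).resolve_left hn |> mul_eq_zero.1).resolve_left (hx u hu)
      rwa [hyperplaneRefl_apply_of_inner_eq_zero h0]
    · exact hz.head ⟨u, hu, hback.symm, h⟩
  rw [← hW.2] at hg
  induction hg using Subgroup.closure_induction_left with
  | one => exact Relation.ReflTransGen.refl
  | mul_left s hs k _ ih =>
    obtain ⟨u, hu, rfl⟩ := hs
    exact hstep u _ hu ih
  | inv_mul_cancel s hs k _ ih =>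
    obtain ⟨u, hu, rfl⟩ := hs
    rw [hyperplaneRefl_inv]
    exact hstep u _ hu ih

theorem SameSide.eq_of_inner_le {W : Subgroup (V ≃ₗᵢ[ℝ] V)} (hW : IsFiniteReflectionGroup W)
    {x y : V} (hx : ∀ u : V, IsRootVector W u → inner ℝ u x ≠ 0) (hy : SameSide W x y)
    {g : V ≃ₗᵢ[ℝ] V} (hg : g ∈ W) (h : inner ℝ x y ≤ inner ℝ x (g y)) : g y = y :=
  (eq_or_inner_lt_of_reflTransGen_ascends (hy.reflTransGen_ascends hW hx hg)).resolve_right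
    (not_lt.2 h)

end Reflections

/-! ### Chambers as closed cones spanning the space. -/

section Chambers

variable {V : Type*} [NormedAddCommGroup V] [InnerProductSpace ℝ V]

theorem add_mem_openChamber {W : Subgroup (V ≃ₗᵢ[ℝ] V)} {x y z : V}
    (hy : y ∈ openChamber W x) (hz : SameSide W x z) : y + z ∈ openChamber W x := by
  intro u hu
  rw [inner_add_right, mul_add]
  exact add_pos_of_pos_of_nonneg (hy u hu) (hz u hu)

theorem smul_mem_openChamber {W : Subgroup (V ≃ₗᵢ[ℝ] V)} {x y : V} {t : ℝ} (ht : 0 < t)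
    (hy : y ∈ openChamber W x) : t • y ∈ openChamber W x := by
  intro u hu
  rw [inner_smul_right, mul_left_comm]
  exact mul_pos ht (hy u hu)

theorem mem_openChamber_self {W : Subgroup (V ≃ₗᵢ[ℝ] V)} {x : V}
    (hx : ∀ u : V, IsRootVector W u → inner ℝ u x ≠ 0) : x ∈ openChamber W x :=
  fun u hu => mul_self_pos.2 (hx u hu)

theorem closure_openChamber {W : Subgroup (V ≃ₗᵢ[ℝ] V)} {x : V}
    (hx : ∀ u : V, IsRootVector W u → inner ℝ u x ≠ 0) :
    closure (openChamber W x) = {y | SameSide W x y} := by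
  apply Set.Subset.antisymm
  · refine closure_minimal (fun y hy u hu => (hy u hu).le) ?_
    simp only [SameSide, Set.ofPred_forall]
    exact isClosed_iInter fun u => isClosed_iInter fun _ =>
      isClosed_le continuous_const (by fun_prop)
  · intro y hy
    have hlim : Filter.Tendsto (fun t : ℝ => t • x + y) (nhdsWithin 0 (Set.Ioi 0)) (nhds y) := by
      have : Filter.Tendsto (fun t : ℝ => t • x + y) (nhds 0) (nhds ((0 : ℝ) • x + y)) :=
        Continuous.tendsto (by fun_prop) 0
      rw [zero_smul, zero_add] at this
      exact this.mono_left nhdsWithin_le_nhds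
    refine mem_closure_of_tendsto hlim ?_
    filter_upwards [self_mem_nhdsWithin] with t ht
    exact add_mem_openChamber (smul_mem_openChamber ht (mem_openChamber_self hx)) hy

theorem exists_add_smul_sameSide {W : Subgroup (V ≃ₗᵢ[ℝ] V)} [Finite W] {x : V}
    (hx : ∀ u : V, IsRootVector W u → inner ℝ u x ≠ 0) (v : V) :
    ∃ t : ℝ, SameSide W x (v + t • x) := by
  -- Root vectors are only determined up to scaling, so the bound is taken over the finite group,
  -- with `x - s_u x` standing for the normal `u`.
  obtain ⟨M, hM⟩ := Finite.exists_le
    (fun g : W => -inner ℝ v (x - g.1 x) / inner ℝ x (x - g.1 x))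
  refine ⟨M, fun u hu => ?_⟩
  have hn : 0 < 2 / ‖u‖ ^ 2 := by have := norm_pos_iff.mpr hu.1; positivity
  have key : ∀ a : V, inner ℝ a (x - hyperplaneRefl u x) =
      2 / ‖u‖ ^ 2 * (inner ℝ u x * inner ℝ u a) := by
    intro a
    rw [inner_sub_right, inner_hyperplaneRefl]
    ring
  have hpos : 0 < inner ℝ x (x - hyperplaneRefl u x) := by
    rw [key]
    exact mul_pos hn (mul_self_pos.2 (hx u hu))
  have h1 := hM ⟨_, hu.2⟩
  simp only at h1
  rw [div_le_iff₀ hpos] at h1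
  have h2 : 0 ≤ inner ℝ (v + M • x) (x - hyperplaneRefl u x) := by
    rw [inner_add_left, real_inner_smul_left]
    linarith
  rw [key] at h2
  exact nonneg_of_mul_nonneg_right h2 hn

/-- The closed chamber of `x` as a convex cone. -/
def chamberCone (W : Subgroup (V ≃ₗᵢ[ℝ] V)) (x : V) : PointedCone ℝ V where
  carrier := {y | SameSide W x y}
  zero_mem' := fun u _ => by simp
  add_mem' := fun {a b} ha hb u hu => by
    rw [inner_add_right, mul_add]
    exact add_nonneg (ha u hu) (hb u hu)
  smul_mem' := fun c a ha u hu => by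
    rw [← Nonneg.coe_smul, inner_smul_right, mul_left_comm]
    exact mul_nonneg c.2 (ha u hu)

theorem span_cone_chamberCone {W : Subgroup (V ≃ₗᵢ[ℝ] V)} [Finite W] {x : V}
    (hx : ∀ u : V, IsRootVector W u → inner ℝ u x ≠ 0) (g : V ≃ₗᵢ[ℝ] V) :
    Submodule.span ℝ (cone (chamberCone W x : Set V) g) = LinearMap.range (oneSub g) := by
  have htop : Submodule.span ℝ (chamberCone W x : Set V) = ⊤ := by
    rw [eq_top_iff]
    intro v _
    obtain ⟨t, ht⟩ := exists_add_smul_sameSide hx v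
    have hxC : x ∈ (chamberCone W x : Set V) := fun u _ => mul_self_nonneg _
    have := Submodule.sub_mem _ (Submodule.subset_span (R := ℝ) (s := (chamberCone W x : Set V)) ht)
      (Submodule.smul_mem _ t (Submodule.subset_span hxC))
    rwa [add_sub_cancel_right] at this
  rw [cone, Submodule.span_image, htop, LinearMap.range_eq_map]

end Chambers

/-! ### Ranks, kernels and spans of cones. -/

section LinearAlgebra

variable {V : Type*} [NormedAddCommGroup V] [InnerProductSpace ℝ V]

theorem oneSub_apply (g : V ≃ₗᵢ[ℝ] V) (v : V) : oneSub g v = v - g v := rfl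

theorem mem_ker_oneSub {g : V ≃ₗᵢ[ℝ] V} {v : V} : v ∈ LinearMap.ker (oneSub g) ↔ g v = v := by
  rw [LinearMap.mem_ker, oneSub_apply, sub_eq_zero, eq_comm]

theorem exists_sub_of_mem_span (P : PointedCone ℝ V) {v : V}
    (hv : v ∈ Submodule.span ℝ (P : Set V)) : ∃ a ∈ P, ∃ b ∈ P, v = a - b := by
  induction hv using Submodule.span_induction with
  | mem v hv => exact ⟨v, hv, 0, P.zero_mem, by simp⟩
  | zero => exact ⟨0, P.zero_mem, 0, P.zero_mem, by simp⟩
  | add v w _ _ hv hw =>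
    obtain ⟨a, ha, b, hb, rfl⟩ := hv
    obtain ⟨a', ha', b', hb', rfl⟩ := hw
    exact ⟨a + a', P.add_mem ha ha', b + b', P.add_mem hb hb', by abel⟩
  | smul c v _ hv =>
    obtain ⟨a, ha, b, hb, rfl⟩ := hv
    rcases le_total 0 c with hc | hc
    · exact ⟨c • a, P.smul_mem hc ha, c • b, P.smul_mem hc hb, smul_sub c a b⟩
    · refine ⟨(-c) • b, P.smul_mem (neg_nonneg.2 hc) hb, (-c) • a,
        P.smul_mem (neg_nonneg.2 hc) ha, ?_⟩
      rw [smul_sub, neg_smul, neg_smul]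
      abel

theorem rk_mul_le [FiniteDimensional ℝ V] (g h : V ≃ₗᵢ[ℝ] V) : rk (g * h) ≤ rk g + rk h := by
  have hle : LinearMap.range (oneSub (g * h)) ≤
      LinearMap.range (oneSub g) ⊔ LinearMap.range (oneSub h) := by
    rintro _ ⟨v, rfl⟩
    have : oneSub (g * h) v = oneSub g (h v) + oneSub h v := by
      simp only [oneSub_apply, LinearIsometryEquiv.coe_mul, Function.comp_apply]
      abel
    rw [this]
    exact Submodule.add_mem_sup ⟨_, rfl⟩ ⟨_, rfl⟩
  exact (Submodule.finrank_mono hle).trans (Submodule.finrank_add_le_finrank_add_finrank _ _)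

theorem finrank_map_add_finrank_ker [FiniteDimensional ℝ V] {f : V →ₗ[ℝ] V} {L : Submodule ℝ V}
    (h : LinearMap.ker f ≤ L) :
    finrank ℝ (L.map f) + finrank ℝ (LinearMap.ker f) = finrank ℝ L := by
  rw [← LinearMap.finrank_range_add_finrank_ker (f.domRestrict L), LinearMap.range_domRestrict,
    LinearMap.ker_domRestrict]
  congr 1
  exact (Submodule.comapSubtypeEquivOfLe h).finrank_eq.symm

end LinearAlgebra

/-! ### From adjacency of cones to fixed vectors. -/

section Adjacency

variable {V : Type*} [NormedAddCommGroup V] [InnerProductSpace ℝ V]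

/-- If `(1 - w') p = (1 - w' w̃) y` with `p` in the open chamber and `y` in the closed one, then
`w̃` fixes `y`. -/
theorem apply_eq_of_oneSub_eq {W : Subgroup (V ≃ₗᵢ[ℝ] V)} (hW : IsFiniteReflectionGroup W)
    {x p y : V} {g h : V ≃ₗᵢ[ℝ] V} (hh : h ∈ W) (hp : p ∈ openChamber W x) (hy : SameSide W x y)
    (heq : oneSub g p = oneSub (g * h) y) : h y = y := by
  have hpne : ∀ u : V, IsRootVector W u → inner ℝ u p ≠ 0 := fun u hu h0 => by
    simpa [h0] using hp u hu
  have hpy : SameSide W p y := fun u hu => by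
    have h1 := hp u hu
    have h2 := hy u hu
    by_contra! h3
    nlinarith [mul_nonneg h1.le h2, mul_neg_of_pos_of_neg (mul_self_pos.2 (left_ne_zero_of_mul h1.ne')) h3]
  have hsub : p - y = g (p - h y) := by
    rw [oneSub_apply, oneSub_apply, LinearIsometryEquiv.coe_mul, Function.comp_apply] at heq
    rw [map_sub, sub_eq_sub_iff_sub_eq_sub, heq]
  have hnorm : ‖p - y‖ ^ 2 = ‖p - h y‖ ^ 2 := by rw [hsub, LinearIsometryEquiv.norm_map]
  rw [norm_sub_sq_real, norm_sub_sq_real, LinearIsometryEquiv.norm_map] at hnorm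
  exact hpy.eq_of_inner_le hW hpne hh (by linarith)

theorem range_oneSub_le_map_ker {W : Subgroup (V ≃ₗᵢ[ℝ] V)} (hW : IsFiniteReflectionGroup W)
    {x : V} (hx : ∀ u : V, IsRootVector W u → inner ℝ u x ≠ 0) {g h : V ≃ₗᵢ[ℝ] V} (hh : h ∈ W)
    (hspan : LinearMap.range (oneSub g) ≤ Submodule.span ℝ
      (cone (chamberCone W x : Set V) g ∩ cone (chamberCone W x : Set V) (g * h))) :
    LinearMap.range (oneSub g) ≤ (LinearMap.ker (oneSub h)).map (oneSub (g * h)) := by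
  let S : PointedCone ℝ V := (chamberCone W x).map (oneSub g) ⊓ (chamberCone W x).map (oneSub (g * h))
  have hS : (S : Set V) =
      cone (chamberCone W x : Set V) g ∩ cone (chamberCone W x : Set V) (g * h) := rfl
  rw [← hS] at hspan
  have hinner : ∀ p ∈ openChamber W x, oneSub g p ∈ S →
      oneSub g p ∈ (LinearMap.ker (oneSub h)).map (oneSub (g * h)) := by
    rintro p hp ⟨-, y, hy, hpy⟩
    exact ⟨y, mem_ker_oneSub.2 (apply_eq_of_oneSub_eq hW hh hp hy hpy.symm), hpy⟩
  -- Writing `(1 - g) x = b - a` with `a = (1 - g) c` produces a point `b` of `S` that is the image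
  -- of the interior point `x + c`.
  obtain ⟨b, hb, a, ⟨⟨c, hc, hca⟩, ha⟩, hab⟩ :=
    exists_sub_of_mem_span S (hspan ⟨x, rfl⟩)
  have hp : x + c ∈ openChamber W x := add_mem_openChamber (mem_openChamber_self hx) hc
  have hpb : oneSub g (x + c) = b := by
    have hca' : oneSub g c = a := hca
    rw [map_add, hab, hca', sub_add_cancel]
  refine hspan.trans (Submodule.span_le.2 fun s hs => ?_)
  obtain ⟨⟨e, he, hes⟩, -⟩ := id hs
  have hes' : oneSub g e = s := hes
  -- Any `s ∈ S` is `(b + s) - b`, a difference of two images of interior points.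
  have h1 := hinner _ hp (hpb ▸ hb)
  have h2 := hinner _ (add_mem_openChamber hp he)
    (by rw [map_add, hpb, hes']; exact S.add_mem hb hs)
  rw [map_add, hes'] at h2
  simpa using Submodule.sub_mem _ h2 h1

end Adjacency

end ReflectionTiling

/-! ### The dimension count. -/

theorem lemma5 {V : Type*} [NormedAddCommGroup V] [InnerProductSpace ℝ V] [FiniteDimensional ℝ V]
    (W : Subgroup (V ≃ₗᵢ[ℝ] V)) (hW : ReflectionTiling.IsFiniteReflectionGroup W)
    (C : Set V) (hC : ReflectionTiling.IsFundamentalChamber W C)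
    (n : ℕ)
    (hn : Module.finrank ℝ (ReflectionTiling.fixedSubspace W) + n = Module.finrank ℝ V)
    (w w' wt : V ≃ₗᵢ[ℝ] V) (hw' : w' ∈ W) (hwt : wt ∈ W) (hww : w = w' * wt)
    (hreg : ReflectionTiling.IsRegular W w)
    (hadj : ReflectionTiling.IsAdjacentTo
      (ReflectionTiling.cone C w') (ReflectionTiling.cone C w)) :
    ReflectionTiling.rk w' + ReflectionTiling.rk wt = n := by
  have := hW.1
  obtain ⟨x, hx, rfl⟩ := hC
  rw [ReflectionTiling.closure_openChamber hx] at hadj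
  subst hww
  have hker : LinearMap.ker (ReflectionTiling.oneSub (w' * wt)) =
      ReflectionTiling.fixedSubspace W := by
    ext v
    rw [ReflectionTiling.mem_ker_oneSub]
    exact Set.ext_iff.1 hreg.2 v
  have hrkw := LinearMap.finrank_range_add_finrank_ker (ReflectionTiling.oneSub (w' * wt))
  have hrkt := LinearMap.finrank_range_add_finrank_ker (ReflectionTiling.oneSub wt)
  have hspan : LinearMap.range (ReflectionTiling.oneSub w') ≤ Submodule.span ℝ
      (ReflectionTiling.cone (ReflectionTiling.chamberCone W x : Set V) w' ∩
        ReflectionTiling.cone (ReflectionTiling.chamberCone W x : Set V) (w' * wt)) := by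
    rw [← ReflectionTiling.span_cone_chamberCone hx w']
    exact (Submodule.eq_of_le_of_finrank_eq (Submodule.span_mono Set.inter_subset_left)
      hadj.2.symm).ge
  have hle := Submodule.finrank_mono (ReflectionTiling.range_oneSub_le_map_ker hW hx hwt hspan)
  have hfix : LinearMap.ker (ReflectionTiling.oneSub (w' * wt)) ≤
      LinearMap.ker (ReflectionTiling.oneSub wt) := by
    rw [hker]
    exact fun v hv => ReflectionTiling.mem_ker_oneSub.2 (hv wt hwt)
  have hmap := ReflectionTiling.finrank_map_add_finrank_ker hfix
  have hmul := ReflectionTiling.rk_mul_le w' wt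
  rw [hker] at hrkw hmap
  unfold ReflectionTiling.rk at hmul ⊢
  omega
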